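/- **Theorem 4.1.** There is an absolute constant $c>0$ such that the following holds. Let $q\in[1,\infty)$, let $n\ge 1$ be an integer and let $0<\varepsilon<\tfrac12$. If a quantum algorithm with $T$ queries approximates the mean $a_X=\frac1n\sum_{i=1}^n x_i$ of $n$ Boolean variables $X=(x_1,\dots,x_n)\in\{0,1\}^n$ with worst expected error $$e^{\mathrm{wor\text{-}exp}}(q,\{0,1\}^n,T)=\max_{X\in\{0,1\}^n}\Big(\sum_{j=0}^{M-1}|a_X-\hat a(j)|^q\,p_X(j)\Big)^{1/q}\le\varepsilon ,$$ then $$T\ \ge\ c\,\min\{\varepsilon^{-1},n\}.$$ Here a quantum algorithm with $T$ queries acts on a state space of finitely many qubits, divided into an index register of $a$ qubits, a target register of $b$ qubits and a work register of $c'$ qubits. It prepares the state $|\psi_X\rangle=U_TQ_XU_{T-1}Q_X\cdots U_1Q_XU_0|\psi_0\rangle$, where the unit vector $|\psi_0\rangle$ and the unitary operators $U_0,\dots,U_T$ do not depend on $X$, and $Q_X$ is the query operator $|i\rangle|y\rangle|z\rangle\mapsto|i\rangle|y\oplus\beta(x_{\tau(i)})\rangle|z\rangle$ when $\tau(i)\in\{1,\dots,n\}$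 is defined, and $|i\rangle|y\rangle|z\rangle\mapsto|i\rangle|y\rangle|z\rangle$ otherwise; $\oplus$ is addition modulo $2^b$, and the partial map $\tau$ from $\{0,\dots,2^a-1\}$ to $\{1,\dots,n\}$ and the map $\beta:\{0,1\}\to\{0,\dots,2^b-1\}$ are any maps fixed by the algorithm (for $b=1$ and $\beta(x)=x$ a query is $|i,y,z\rangle\mapsto|i,y\oplus x_{\tau(i)},z\rangle$). It then performs one measurement with $M$ outcomes, given by positive semidefinite operators $E_0,\dots,E_{M-1}$ independent of $X$ with $\sum_jE_j=I$, so that outcome $j$ has probability $p_X(j)=\langle\psi_X|E_j|\psi_X\rangle$, and on outcome $j$ it outputs the real number $\hat a(j)$. -/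

import Mathlib

namespace BooleanMean

/-- The mean `a_X = |X| / n` of `n` Boolean variables `X = (x_1, …, x_n)`. -/
noncomputable def mean {n : ℕ} (X : Fin n → Bool) : ℝ :=
  (∑ i, if X i then (1 : ℝ) else 0) / n

/-- Computational basis of `a + b + c` qubits, grouped in an index register of `a` qubits, a target
register of `b` qubits and a work register of `c` qubits. The basis states of each register are
numbered by integers in the usual way. -/
abbrev Basis (a b c : ℕ) : Type := Fin (2 ^ a) × Fin (2 ^ b) × Fin (2 ^ c)

/-- The permutation of the basis states performed by one query on input `X`:
`|i⟩|y⟩|z⟩ ↦ |i⟩|y ⊕ β (x_{τ(i)})⟩|z⟩` with `⊕` addition modulo `2 ^ b`, and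
`|i⟩|y⟩|z⟩ ↦ |i⟩|y⟩|z⟩` if `i` is not the address of a variable (`τ i = none`).
For `b = 1`, `β 0 = 0`, `β 1 = 1` and `τ i = i`, this is `|i, y, z⟩ ↦ |i, y xor x_i, z⟩`. -/
def queryPerm {n a b c : ℕ} (τ : Fin (2 ^ a) → Option (Fin n)) (β : Bool → Fin (2 ^ b))
    (X : Fin n → Bool) : Equiv.Perm (Basis a b c) where
  toFun s := (s.1, (match τ s.1 with
    | some k => s.2.1 + β (X k)
    | none => s.2.1), s.2.2)
  invFun s := (s.1, (match τ s.1 with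
    | some k => s.2.1 - β (X k)
    | none => s.2.1), s.2.2)
  left_inv := by
    rintro ⟨i, y, z⟩
    cases h : τ i <;> simp [h]
  right_inv := by
    rintro ⟨i, y, z⟩
    cases h : τ i <;> simp [h]

/-- The unitary query operator `Q_X`: the linear extension of `|s⟩ ↦ |queryPerm τ β X s⟩`,
acting on vectors given by their coordinates in the computational basis. -/
def query {n a b c : ℕ} (τ : Fin (2 ^ a) → Option (Fin n)) (β : Bool → Fin (2 ^ b))
    (X : Fin n → Bool) (ψ : Basis a b c → ℂ) : Basis a b c → ℂ :=
  fun s => ψ ((queryPerm τ β X).symm s)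

open scoped ComplexOrder in
/-- A quantum algorithm with `T` queries, on inputs of `n` Boolean variables, that outputs a real
number. None of its data depends on the input, which is accessed only through `Q_X`. -/
structure QueryAlgorithm (n T : ℕ) where
  /-- number of qubits of the index register -/
  a : ℕ
  /-- number of qubits of the target register -/
  b : ℕ
  /-- number of qubits of the work register -/
  c : ℕ
  /-- the variable addressed by an index -/
  τ : Fin (2 ^ a) → Option (Fin n)
  /-- the encoding of the answers in the target register -/
  β : Bool → Fin (2 ^ b)
  /-- the initial state -/
  init : Basis a b c → ℂ
  init_unit : ∑ s, ‖init s‖ ^ 2 = 1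
  /-- the unitary transformations `U_0, …, U_T` -/
  U : Fin (T + 1) → Matrix.unitaryGroup (Basis a b c) ℂ
  /-- the number of outcomes of the measurement -/
  M : ℕ
  /-- the measurement operators: positive semidefinite with sum the identity; orthogonal
  projections and measurement in the computational basis are special cases -/
  E : Fin M → Matrix (Basis a b c) (Basis a b c) ℂ
  E_pos : ∀ j, (E j).PosSemidef
  E_sum : ∑ j, E j = 1
  /-- the approximation of the mean that is output on each outcome -/
  estimate : Fin M → ℝ

namespace QueryAlgorithm

variable {n T : ℕ} (A : QueryAlgorithm n T)

/-- The state `U_t Q_X U_{t-1} Q_X ⋯ U_1 Q_X U_0 |ψ_0⟩`. -/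
noncomputable def stateAfter (X : Fin n → Bool) :
    (t : ℕ) → t < T + 1 → (Basis A.a A.b A.c → ℂ)
  | 0, h => Matrix.mulVec (A.U ⟨0, h⟩).1 A.init
  | t + 1, h => Matrix.mulVec (A.U ⟨t + 1, h⟩).1
      (query A.τ A.β X (stateAfter X t (Nat.lt_of_succ_lt h)))

/-- The final state `|ψ⟩ = U_T Q_X U_{T-1} Q_X ⋯ U_1 Q_X U_0 |ψ_0⟩`. -/
noncomputable def finalState (X : Fin n → Bool) : Basis A.a A.b A.c → ℂ :=
  A.stateAfter X T (Nat.lt_succ_self T)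

/-- The probability `p_X(j) = ⟨ψ| E_j |ψ⟩` of outcome `j` on input `X`. -/
noncomputable def outcomeProb (X : Fin n → Bool) (j : Fin A.M) : ℝ :=
  (dotProduct (star (A.finalState X)) (Matrix.mulVec (A.E j) (A.finalState X))).re

/-- The expected error on input `X`: the `L^q` norm of the error over the outcomes. -/
noncomputable def expectedError (q : ℝ) (X : Fin n → Bool) : ℝ :=
  (∑ j, |mean X - A.estimate j| ^ q * A.outcomeProb X j) ^ (1 / q)

/-- The worst expected error: the maximum of the expected error over all inputs. -/
noncomputable def worstExpectedError (q : ℝ) : ℝ :=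
  Finset.univ.sup' Finset.univ_nonempty (A.expectedError q)

end QueryAlgorithm

end BooleanMean

/-! This is a hybrid argument averaged over a hypercube. Cut the variables into `N = n / D` blocks
with `D` about `32εn`, and use inputs constant on each block. Flipping a block moves the mean by at
least `32ε`, so the final states must have overlap at most `2/5` (`overlap_finalState_le`). Sum the
overlaps over all ordered edges of the cube: the sum starts at `2^N * N`, and a query lowers it by
at most `2 * 2^N`, because the weight of each state is shared among the blocks
(`totalOverlap_succ`). Hence `N` is `O(T)`, that is, `T` is at least of order `min ε⁻¹ n`. -/

namespace BooleanMean

open Matrix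

/-! ### Overlaps and positive semidefinite forms -/

section States

variable {S : Type*} [Fintype S]

/-- The real part of the inner product of two vectors given by coordinates. -/
noncomputable def overlap (ψ φ : S → ℂ) : ℝ := (star ψ ⬝ᵥ φ).re

theorem overlap_eq_sum (ψ φ : S → ℂ) : overlap ψ φ = ∑ s, (star (ψ s) * φ s).re := by
  simp [overlap, dotProduct]

theorem overlap_self (ψ : S → ℂ) : overlap ψ ψ = ∑ s, ‖ψ s‖ ^ 2 := by
  rw [overlap_eq_sum]
  refine Finset.sum_congr rfl fun s _ => ?_
  rw [← Complex.normSq_eq_norm_sq, Complex.normSq_apply]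
  simp [Complex.mul_re]

theorem neg_norm_sq_le_re_star_mul (z w : ℂ) :
    -((‖z‖ ^ 2 + ‖w‖ ^ 2) / 2) ≤ (star z * w).re := by
  rw [← Complex.normSq_eq_norm_sq, ← Complex.normSq_eq_norm_sq, Complex.normSq_apply,
    Complex.normSq_apply]
  simp only [Complex.star_def, Complex.mul_re, Complex.conj_re, Complex.conj_im]
  nlinarith [sq_nonneg (z.re + w.re), sq_nonneg (z.im + w.im)]

theorem re_star_mul_le_norm_sq (z w : ℂ) :
    (star z * w).re ≤ (‖z‖ ^ 2 + ‖w‖ ^ 2) / 2 := by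
  have h := neg_norm_sq_le_re_star_mul z (-w)
  simp only [norm_neg, mul_neg, Complex.neg_re] at h
  linarith

theorem overlap_unitary [DecidableEq S] (U : unitaryGroup S ℂ) (ψ φ : S → ℂ) :
    overlap (U.1 *ᵥ ψ) (U.1 *ᵥ φ) = overlap ψ φ := by
  have hU : (U.1)ᴴ * U.1 = 1 := mem_unitaryGroup_iff'.1 U.2
  unfold overlap
  rw [star_mulVec, ← dotProduct_mulVec, mulVec_mulVec, hU, one_mulVec]

-- Cauchy–Schwarz in weighted AM-GM form: the form is nonnegative at `± l ψ + φ`. The free weight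
-- `l` is tuned later.
open scoped ComplexOrder in
theorem abs_re_form_le {E : Matrix S S ℂ} (hE : E.PosSemidef) (ψ φ : S → ℂ) {l : ℝ}
    (hl : 0 < l) :
    |(star ψ ⬝ᵥ (E *ᵥ φ)).re| ≤
      (l * (star ψ ⬝ᵥ (E *ᵥ ψ)).re + l⁻¹ * (star φ ⬝ᵥ (E *ᵥ φ)).re) / 2 := by
  have hsymm : (star φ ⬝ᵥ (E *ᵥ ψ)).re = (star ψ ⬝ᵥ (E *ᵥ φ)).re := by
    have : star (star ψ ⬝ᵥ (E *ᵥ φ)) = star φ ⬝ᵥ (E *ᵥ ψ) := by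
      rw [← star_dotProduct_star, star_star, star_mulVec, hE.1.eq, ← dotProduct_mulVec]
    rw [← this]; simp
  have key : ∀ r : ℝ, 0 ≤ r ^ 2 * (star ψ ⬝ᵥ (E *ᵥ ψ)).re
      + 2 * r * (star ψ ⬝ᵥ (E *ᵥ φ)).re + (star φ ⬝ᵥ (E *ᵥ φ)).re := by
    intro r
    have h := hE.re_dotProduct_nonneg ((r : ℂ) • ψ + φ)
    simp only [star_add, star_smul, mulVec_add, mulVec_smul, add_dotProduct, dotProduct_add,
      smul_dotProduct, dotProduct_smul, smul_eq_mul, Complex.star_def, Complex.conj_ofReal,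
      RCLike.re_to_complex, Complex.add_re, Complex.re_ofReal_mul, hsymm] at h
    linarith
  have h1 := key l
  have h2 := key (-l)
  have hli : l * l⁻¹ = 1 := mul_inv_cancel₀ hl.ne'
  have hi : 0 < l⁻¹ := inv_pos.2 hl
  have e : ∀ a b c : ℝ, l⁻¹ * (l ^ 2 * a + 2 * l * b + c) = l * a + 2 * b + l⁻¹ * c := by
    intro a b c; field_simp
  have e' : ∀ a b c : ℝ, l⁻¹ * ((-l) ^ 2 * a + 2 * -l * b + c) = l * a - 2 * b + l⁻¹ * c := by
    intro a b c; field_simp; ring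
  have g1 := mul_nonneg hi.le h1
  have g2 := mul_nonneg hi.le h2
  rw [e] at g1
  rw [e'] at g2
  rw [abs_le]
  constructor <;> linarith

end States

/-! ### Effect of one query on overlaps -/

section Query

variable {n a b c : ℕ} (τ : Fin (2 ^ a) → Option (Fin n)) (β : Bool → Fin (2 ^ b))

theorem queryPerm_symm_congr {X Y : Fin n → Bool} {s : Basis a b c}
    (h : ∀ v, τ s.1 = some v → X v = Y v) :
    (queryPerm τ β X).symm s = (queryPerm τ β Y).symm s := by
  simp only [queryPerm, Equiv.coe_fn_symm_mk]
  cases hv : τ s.1 with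
  | none => rfl
  | some v => simp [h v hv]

theorem sum_query_symm (X : Fin n → Bool) (f : Fin (2 ^ a) → ℝ) (g : Basis a b c → ℝ) :
    ∑ s : Basis a b c, f s.1 * g ((queryPerm τ β X).symm s) = ∑ s : Basis a b c, f s.1 * g s :=
  Equiv.sum_comp (queryPerm τ β X).symm fun s : Basis a b c => f s.1 * g s

theorem overlap_query_self (X : Fin n → Bool) (ψ φ : Basis a b c → ℂ) :
    overlap (query τ β X ψ) (query τ β X φ) = overlap ψ φ := by
  simp only [overlap_eq_sum, query]
  exact Equiv.sum_comp (queryPerm τ β X).symm fun s => (star (ψ s) * φ s).re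

/-- One query changes the overlap of the states of two inputs by at most the weight of the two
states on the indices at which the inputs differ. -/
theorem overlap_query_ge {X Y : Fin n → Bool} {χ : Fin (2 ^ a) → ℝ}
    (hχ : ∀ i, χ i = 1 ∨ χ i = 0 ∧ ∀ v, τ i = some v → X v = Y v)
    (ψ φ : Basis a b c → ℂ) :
    overlap ψ φ - ∑ s, χ s.1 * (‖ψ s‖ ^ 2 + ‖φ s‖ ^ 2) ≤
      overlap (query τ β X ψ) (query τ β Y φ) := by
  -- Where `χ = 0` both queries are the same permutation and keep the overlap. Where `χ = 1`, half
  -- of the loss is paid before the query and half after; queries preserve the index register, hence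
  -- these weights.
  have h1 : ∑ s : Basis a b c, ((1 - χ s.1) * (star (ψ ((queryPerm τ β X).symm s)) *
        φ ((queryPerm τ β X).symm s)).re
      - (χ s.1 / 2 * ‖ψ ((queryPerm τ β X).symm s)‖ ^ 2
        + χ s.1 / 2 * ‖φ ((queryPerm τ β Y).symm s)‖ ^ 2)) ≤
      overlap (query τ β X ψ) (query τ β Y φ) := by
    rw [overlap_eq_sum]
    refine Finset.sum_le_sum fun s _ => ?_
    simp only [query]
    rcases hχ s.1 with h | ⟨h, hXY⟩
    · rw [h]
      have := neg_norm_sq_le_re_star_mul (ψ ((queryPerm τ β X).symm s))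
        (φ ((queryPerm τ β Y).symm s))
      linarith
    · rw [h, queryPerm_symm_congr τ β hXY]
      simp
  refine le_trans ?_ h1
  rw [Finset.sum_sub_distrib, Finset.sum_add_distrib,
    sum_query_symm τ β X (fun i => 1 - χ i) (fun s => (star (ψ s) * φ s).re),
    sum_query_symm τ β X (fun i => χ i / 2) (fun s => ‖ψ s‖ ^ 2),
    sum_query_symm τ β Y (fun i => χ i / 2) (fun s => ‖φ s‖ ^ 2),
    ← Finset.sum_add_distrib, ← Finset.sum_sub_distrib, overlap_eq_sum, ← Finset.sum_sub_distrib]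
  refine Finset.sum_le_sum fun s _ => ?_
  rcases hχ s.1 with h | ⟨h, -⟩
  · rw [h]
    have := re_star_mul_le_norm_sq (ψ s) (φ s)
    linarith
  · rw [h]; simp

end Query

/-! ### Accuracy forces small final overlap -/

namespace QueryAlgorithm

variable {n T : ℕ} (A : QueryAlgorithm n T)

theorem overlap_stateAfter_self (X : Fin n → Bool) (t : ℕ) (h : t < T + 1) :
    overlap (A.stateAfter X t h) (A.stateAfter X t h) = 1 := by
  induction t with
  | zero => rw [stateAfter, overlap_unitary, overlap_self, A.init_unit]
  | succ t ih => rw [stateAfter, overlap_unitary, overlap_query_self, ih]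

theorem outcomeProb_nonneg (X : Fin n → Bool) (j : Fin A.M) : 0 ≤ A.outcomeProb X j :=
  (A.E_pos j).re_dotProduct_nonneg _

theorem sum_re_form (ψ φ : Basis A.a A.b A.c → ℂ) :
    ∑ j, (star ψ ⬝ᵥ (A.E j *ᵥ φ)).re = overlap ψ φ := by
  rw [overlap, ← Complex.re_sum, ← dotProduct_sum, ← sum_mulVec, A.E_sum, one_mulVec]

theorem sum_outcomeProb (X : Fin n → Bool) : ∑ j, A.outcomeProb X j = 1 :=
  (A.sum_re_form _ _).trans (A.overlap_stateAfter_self X T _)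

/-- The power mean inequality reduces every `q ≥ 1` to the mean absolute error. -/
theorem sum_abs_mul_outcomeProb_le {q : ℝ} (hq : 1 ≤ q) (X : Fin n → Bool) :
    ∑ j, |mean X - A.estimate j| * A.outcomeProb X j ≤ A.worstExpectedError q := by
  have h1 := Real.arith_mean_le_rpow_mean Finset.univ (A.outcomeProb X)
    (fun j => |mean X - A.estimate j|) (fun j _ => A.outcomeProb_nonneg X j)
    (A.sum_outcomeProb X) (fun j _ => abs_nonneg _) hq
  have h2 : A.expectedError q X ≤ A.worstExpectedError q :=
    Finset.le_sup' (A.expectedError q) (Finset.mem_univ X)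
  refine le_trans ?_ h2
  simpa only [expectedError, mul_comm] using h1

/-- An algorithm that makes no query has worst expected error at least `1 / 2`. -/
theorem half_le_of_no_queries (A : QueryAlgorithm n 0) (hn : 1 ≤ n) {q : ℝ} (hq : 1 ≤ q) :
    1 / 2 ≤ A.worstExpectedError q := by
  have h0 := A.sum_abs_mul_outcomeProb_le hq (fun _ => false)
  have h1 := A.sum_abs_mul_outcomeProb_le hq (fun _ => true)
  have hp : A.outcomeProb (fun _ => true) = A.outcomeProb (fun _ => false) := rfl
  have hn' : (n : ℝ) ≠ 0 := by positivity
  have m0 : mean (fun _ : Fin n => false) = 0 := by simp [mean]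
  have m1 : mean (fun _ : Fin n => true) = 1 := by simp [mean, hn']
  rw [m0] at h0
  rw [m1, hp] at h1
  have h2 : ∑ j, A.outcomeProb (fun _ => false) j ≤
      ∑ j, (|0 - A.estimate j| * A.outcomeProb (fun _ => false) j
        + |1 - A.estimate j| * A.outcomeProb (fun _ => false) j) := by
    refine Finset.sum_le_sum fun j _ => ?_
    rw [← add_mul]
    refine le_mul_of_one_le_left (A.outcomeProb_nonneg _ j) ?_
    have g1 := neg_abs_le (0 - A.estimate j)
    have g2 := le_abs_self (1 - A.estimate j)
    linarith
  rw [A.sum_outcomeProb, Finset.sum_add_distrib] at h2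
  linarith

/-- If the means of two inputs are much further apart than the error, the final states have
small overlap. -/
theorem overlap_finalState_le {ε : ℝ} (X Y : Fin n → Bool) (hε : 0 < ε)
    (hX : ∑ j, |mean X - A.estimate j| * A.outcomeProb X j ≤ ε)
    (hY : ∑ j, |mean Y - A.estimate j| * A.outcomeProb Y j ≤ ε)
    (hXY : 32 * ε ≤ |mean X - mean Y|) :
    overlap (A.finalState X) (A.finalState Y) ≤ 2 / 5 := by
  set δ := |mean X - mean Y| with hδ
  -- Split `δ` by the triangle inequality and weight each part by 4 towards the input whose error it
  -- is. Summed, the overlap is at most `17ε/(4δ) + 1/4`, and `17/128 + 1/4 < 2/5`.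
  have hterm : ∀ j, δ * (star (A.finalState X) ⬝ᵥ (A.E j *ᵥ A.finalState Y)).re ≤
      (17 / 8) * (|mean X - A.estimate j| * A.outcomeProb X j)
      + (17 / 8) * (|mean Y - A.estimate j| * A.outcomeProb Y j)
      + δ / 8 * A.outcomeProb X j + δ / 8 * A.outcomeProb Y j := by
    intro j
    have h4 := abs_re_form_le (A.E_pos j) (A.finalState X) (A.finalState Y) (l := 4) (by norm_num)
    have h4' := abs_re_form_le (A.E_pos j) (A.finalState X) (A.finalState Y) (l := 4⁻¹)
      (by norm_num)
    rw [inv_inv] at h4'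
    change _ ≤ (4 * A.outcomeProb X j + 4⁻¹ * A.outcomeProb Y j) / 2 at h4
    change _ ≤ (4⁻¹ * A.outcomeProb X j + 4 * A.outcomeProb Y j) / 2 at h4'
    have pX := A.outcomeProb_nonneg X j
    have pY := A.outcomeProb_nonneg Y j
    generalize (star (A.finalState X) ⬝ᵥ (A.E j *ᵥ A.finalState Y)).re = r at h4 h4' ⊢
    generalize A.outcomeProb X j = x at *
    generalize A.outcomeProb Y j = y at *
    have ht : δ ≤ |mean X - A.estimate j| + |mean Y - A.estimate j| := by
      rw [hδ, abs_sub_comm (mean Y)]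
      exact abs_sub_le _ _ _
    have htX : |mean X - A.estimate j| ≤ δ + |mean Y - A.estimate j| := abs_sub_le _ _ _
    have htY : |mean Y - A.estimate j| ≤ δ + |mean X - A.estimate j| := by
      rw [hδ, abs_sub_comm (mean X) (mean Y)]
      exact abs_sub_le _ _ _
    have dX := abs_nonneg (mean X - A.estimate j)
    have dY := abs_nonneg (mean Y - A.estimate j)
    have hd : 0 ≤ δ := abs_nonneg _
    generalize |mean X - A.estimate j| = u at *
    generalize |mean Y - A.estimate j| = w at *
    have g0 : δ * r ≤ (u + w) * |r| :=
      (mul_le_mul_of_nonneg_left (le_abs_self r) hd).trans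
        (mul_le_mul_of_nonneg_right ht (abs_nonneg r))
    have g1 := mul_le_mul_of_nonneg_left h4 dX
    have g2 := mul_le_mul_of_nonneg_left h4' dY
    have g3 := mul_le_mul_of_nonneg_right htX pY
    have g4 := mul_le_mul_of_nonneg_right htY pX
    linarith
  have hsum := Finset.sum_le_sum fun j (_ : j ∈ Finset.univ) => hterm j
  simp only [Finset.sum_add_distrib, ← Finset.mul_sum, sum_re_form, sum_outcomeProb] at hsum
  have hd : 0 < δ := by linarith
  by_contra! hcon
  have := mul_lt_mul_of_pos_left hcon hd
  linarith

end QueryAlgorithm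

/-! ### Hybrid argument on the cube of blocks -/

section Blocks

variable {n N : ℕ}

/-- The input whose variables in block `k` all have the value `Z k`, and whose variables outside
the blocks are zero; `g` assigns blocks to variables. -/
def blockInput (g : Fin n → Option (Fin N)) (Z : Fin N → Bool) : Fin n → Bool :=
  fun v => (g v).elim false Z

/-- Negation of the bit `k`. -/
def flipBit (k : Fin N) (Z : Fin N → Bool) : Fin N → Bool := Function.update Z k (!Z k)

theorem flipBit_involutive (k : Fin N) : Function.Involutive (flipBit k) := by
  intro Z
  simp [flipBit]

/-- The total overlap, over all edges of the hypercube, of the states after `t` queries. -/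
noncomputable def totalOverlap {T : ℕ} (A : QueryAlgorithm n T) (g : Fin n → Option (Fin N))
    (t : ℕ) (h : t < T + 1) : ℝ :=
  ∑ Z : Fin N → Bool, ∑ k, overlap (A.stateAfter (blockInput g Z) t h)
    (A.stateAfter (blockInput g (flipBit k Z)) t h)

theorem totalOverlap_succ {T : ℕ} (A : QueryAlgorithm n T) (g : Fin n → Option (Fin N))
    (t : ℕ) (h : t + 1 < T + 1) :
    totalOverlap A g t (Nat.lt_of_succ_lt h) - 2 * 2 ^ N ≤ totalOverlap A g (t + 1) h := by
  classical
  have h' := Nat.lt_of_succ_lt h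
  let χ : Fin N → Fin (2 ^ A.a) → ℝ := fun k i => if (A.τ i).bind g = some k then 1 else 0
  let w : (Fin N → Bool) → Fin N → ℝ := fun Z k =>
    ∑ s, χ k s.1 * ‖A.stateAfter (blockInput g Z) t h' s‖ ^ 2
  have hstep : ∀ Z k, overlap (A.stateAfter (blockInput g Z) t h')
      (A.stateAfter (blockInput g (flipBit k Z)) t h') - (w Z k + w (flipBit k Z) k) ≤
      overlap (A.stateAfter (blockInput g Z) (t + 1) h)
        (A.stateAfter (blockInput g (flipBit k Z)) (t + 1) h) := by
    intro Z k
    simp only [QueryAlgorithm.stateAfter, overlap_unitary]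
    refine le_trans (le_of_eq ?_) (overlap_query_ge A.τ A.β (χ := χ k) ?_ _ _)
    · simp only [w, mul_add, Finset.sum_add_distrib]
    · intro i
      by_cases hi : (A.τ i).bind g = some k
      · exact Or.inl (if_pos hi)
      · refine Or.inr ⟨if_neg hi, fun v hv => ?_⟩
        rw [hv, Option.bind_some] at hi
        simp only [blockInput]
        cases hg : g v with
        | none => rfl
        | some l =>
          have hlk : l ≠ k := fun e => hi (by rw [hg, e])
          simp [flipBit, hlk]
  -- An index lies in at most one block, so the block weights of a unit vector sum to at most 1.
  have hw : ∀ Z, ∑ k, w Z k ≤ 1 := by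
    intro Z
    rw [← A.overlap_stateAfter_self (blockInput g Z) t h', overlap_self, Finset.sum_comm]
    refine Finset.sum_le_sum fun s _ => ?_
    rw [← Finset.sum_mul]
    refine mul_le_of_le_one_left (by positivity) ?_
    simp only [χ]
    cases (A.τ s.1).bind g with
    | none => simp
    | some l => simp
  have hw1 : ∑ Z, ∑ k, w Z k ≤ 2 ^ N := by
    refine (Finset.sum_le_sum fun Z _ => hw Z).trans (le_of_eq ?_)
    simp
  have hw2 : ∑ Z, ∑ k, w (flipBit k Z) k = ∑ Z, ∑ k, w Z k := by
    rw [Finset.sum_comm, Finset.sum_comm (f := fun Z k => w Z k)]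
    refine Finset.sum_congr rfl fun k _ => ?_
    exact Equiv.sum_comp (flipBit_involutive k).toPerm fun Z => w Z k
  have hsum := Finset.sum_le_sum fun Z (_ : Z ∈ Finset.univ) =>
    Finset.sum_le_sum fun k (_ : k ∈ Finset.univ) => hstep Z k
  simp only [Finset.sum_sub_distrib, Finset.sum_add_distrib, hw2] at hsum
  unfold totalOverlap
  linarith

theorem totalOverlap_ge {T : ℕ} (A : QueryAlgorithm n T) (g : Fin n → Option (Fin N))
    (t : ℕ) (h : t < T + 1) : 2 ^ N * ((N : ℝ) - 2 * t) ≤ totalOverlap A g t h := by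
  induction t with
  | zero =>
    have h1 : ∀ X Y, overlap (A.stateAfter X 0 h) (A.stateAfter Y 0 h) = 1 := fun X _ =>
      A.overlap_stateAfter_self X 0 h
    simp [totalOverlap, h1]
  | succ t ih =>
    have h1 := ih (Nat.lt_of_succ_lt h)
    have h2 := totalOverlap_succ A g t h
    push_cast
    linarith

theorem card_le_two_mul_queries {T : ℕ} (A : QueryAlgorithm n T) (g : Fin n → Option (Fin N))
    {r : ℝ} (hr : ∀ Z k, overlap (A.finalState (blockInput g Z))
      (A.finalState (blockInput g (flipBit k Z))) ≤ r) : (1 - r) * N ≤ 2 * T := by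
  have h1 := totalOverlap_ge A g T (Nat.lt_succ_self T)
  have h2 : totalOverlap A g T (Nat.lt_succ_self T) ≤ 2 ^ N * (N * r) := by
    refine (Finset.sum_le_sum fun Z _ => Finset.sum_le_sum fun k _ => hr Z k).trans (le_of_eq ?_)
    simp
  have h3 := le_of_mul_le_mul_left (h1.trans h2) (by positivity)
  linarith

theorem mean_blockInput_flipBit (g : Fin n → Option (Fin N)) (Z : Fin N → Bool) (k : Fin N) :
    |mean (blockInput g Z) - mean (blockInput g (flipBit k Z))| =
      (Finset.univ.filter fun v => g v = some k).card / n := by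
  have hb : ∀ v, ((if blockInput g Z v then (1 : ℝ) else 0)
      - if blockInput g (flipBit k Z) v then (1 : ℝ) else 0) =
      (if Z k then 1 else -1) * if g v = some k then 1 else 0 := by
    intro v
    rcases Option.eq_none_or_eq_some (g v) with hg | ⟨l, hg⟩
    · simp [blockInput, hg]
    · by_cases hl : l = k
      · subst hl
        cases hZ : Z l <;> simp [blockInput, hg, flipBit, hZ]
      · simp [blockInput, hg, flipBit, hl]
  have hs : |if Z k then (1 : ℝ) else -1| = 1 := by split_ifs <;> simp
  rw [mean, mean, ← sub_div, ← Finset.sum_sub_distrib, Finset.sum_congr rfl fun v _ => hb v,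
    ← Finset.mul_sum, Finset.sum_boole, abs_div, abs_mul, hs, one_mul, Nat.abs_cast, Nat.abs_cast]

/-- The assignment of `n` variables to `n / D` consecutive blocks of length `D`. -/
def consecutiveBlock (n D : ℕ) (v : Fin n) : Option (Fin (n / D)) :=
  if h : v.1 / D < n / D then some ⟨v.1 / D, h⟩ else none

theorem le_card_consecutiveBlock {D : ℕ} (hD : 0 < D) (k : Fin (n / D)) :
    D ≤ (Finset.univ.filter fun v => consecutiveBlock n D v = some k).card := by
  have hk : (k.1 + 1) * D ≤ n :=
    (Nat.mul_le_mul_right D k.2).trans (Nat.div_mul_le_self n D)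
  have hlt : ∀ i : Fin D, D * k.1 + i.1 < n := fun i => by
    have := i.2
    rw [add_mul, mul_comm] at hk
    omega
  have hdiv : ∀ i : Fin D, (D * k.1 + i.1) / D = k.1 := fun i => by
    rw [Nat.mul_add_div hD, Nat.div_eq_of_lt i.2, add_zero]
  have hinj : Function.Injective fun i : Fin D => (⟨D * k.1 + i.1, hlt i⟩ : Fin n) := by
    intro i j hij
    simpa [Fin.ext_iff] using hij
  have := Finset.card_le_card_of_injOn (s := (Finset.univ : Finset (Fin D)))
    (t := Finset.univ.filter fun v => consecutiveBlock n D v = some k)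
    (fun i : Fin D => (⟨D * k.1 + i.1, hlt i⟩ : Fin n))
    (fun i _ => by simp [consecutiveBlock, hdiv]) hinj.injOn
  simpa using this

end Blocks

end BooleanMean

/-! ### Choice of block length and constants -/

theorem theorem4p1 :
    ∃ c : ℝ, 0 < c ∧
      ∀ q : ℝ, 1 ≤ q →
        ∀ n : ℕ, 1 ≤ n →
          ∀ ε : ℝ, 0 < ε → ε < 1 / 2 →
            ∀ (T : ℕ) (A : BooleanMean.QueryAlgorithm n T),
              A.worstExpectedError q ≤ ε → c * min ε⁻¹ (n : ℝ) ≤ (T : ℝ) := by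
  refine ⟨1 / 165, by norm_num, fun q hq n hn ε hε hε2 T A hA => ?_⟩
  -- Needed below to absorb the rounding in `n / D`.
  have hT : (1 : ℝ) ≤ T := by
    rcases Nat.eq_zero_or_pos T with rfl | h
    · exact absurd (A.half_le_of_no_queries hn hq) (by linarith)
    · exact_mod_cast h
  have hn' : (0 : ℝ) < n := by exact_mod_cast hn
  set D := ⌊32 * ε * n⌋₊ + 1 with hD
  have hD0 : 0 < D := Nat.succ_pos _
  have hD1 : 32 * ε * n ≤ D := by
    rw [hD]; push_cast; exact (Nat.lt_floor_add_one _).le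
  have hD2 : (D : ℝ) ≤ 32 * ε * n + 1 := by
    rw [hD]; push_cast
    have := Nat.floor_le (a := 32 * ε * n) (by positivity)
    linarith
  have herr := fun X => (A.sum_abs_mul_outcomeProb_le hq X).trans hA
  have hN : (1 - 2 / 5) * ((n / D : ℕ) : ℝ) ≤ 2 * T := by
    refine BooleanMean.card_le_two_mul_queries A (BooleanMean.consecutiveBlock n D) fun Z k => ?_
    refine A.overlap_finalState_le _ _ hε (herr _) (herr _) ?_
    rw [BooleanMean.mean_blockInput_flipBit, le_div_iff₀ hn']
    refine hD1.trans ?_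
    exact_mod_cast BooleanMean.le_card_consecutiveBlock hD0 k
  have hND : (n : ℝ) ≤ D * ((n / D : ℕ) + 1) := by
    exact_mod_cast (Nat.lt_mul_div_succ n hD0).le
  -- `n / D + 1 ≤ 10T/3 + T ≤ 5T`; with the factor 33 in `h6` this gives `165 = 33 * 5`.
  have h5 : (n : ℝ) ≤ (32 * ε * n + 1) * (5 * T) := by
    refine hND.trans (mul_le_mul hD2 (by linarith) (by positivity) (by positivity))
  set m := min ε⁻¹ (n : ℝ) with hm
  have hm0 : 0 < m := lt_min (inv_pos.2 hε) hn'
  have hm1 : m * ε ≤ 1 :=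
    (mul_le_mul_of_nonneg_right (min_le_left _ _) hε.le).trans (inv_mul_cancel₀ hε.ne').le
  have hm2 : m ≤ n := min_le_right _ _
  have h6 : m * (32 * ε * n + 1) ≤ 33 * n := by
    have := mul_le_mul_of_nonneg_right hm1 hn'.le
    linarith
  have h7 : m * n ≤ n * (165 * T) := by
    calc m * n ≤ m * ((32 * ε * n + 1) * (5 * T)) := mul_le_mul_of_nonneg_left h5 hm0.le
      _ = (m * (32 * ε * n + 1)) * (5 * T) := by ring
      _ ≤ (33 * n) * (5 * T) := mul_le_mul_of_nonneg_right h6 (by positivity)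
      _ = n * (165 * T) := by ring
  rw [mul_comm] at h7
  have := le_of_mul_le_mul_left h7 hn'
  linarith
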